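/- **Lower Dimension Criterion for Admissibility.** Let $\Phi$ be a self-similar system, i.e. a nonempty finite set of maps $\varphi:X\to X$ of a complete metric space $(X,d)$ (with at least two points) such that $d(\varphi(x),\varphi(y))=\lambda_\varphi\,d(x,y)$ for all $x,y\in X$, with scaling ratio $\lambda_\varphi\in(0,1)$. Let $r_1>\dots>r_M$ be the distinct scaling ratios of $\Phi$, with multiplicities $m_1,\dots,m_M$, and let the lower similarity dimension $D_\ell$ of $\Phi$ be the unique real solution of $$\frac1{m_M}\,(r_M^{-1})^{D_\ell}+\sum_{k=1}^{M-1}\frac{m_k}{m_M}\Big(\frac{r_k}{r_M}\Big)^{D_\ell}=1 .$$ Let $\zeta_\Phi(s)=\big(1-\sum_{\varphi\in\Phi}\lambda_\varphi^s\big)^{-1}$ be the scaling zeta function of $\Phi$. For $R:(0,\infty)\to\mathbb R$ and $\delta>0$ let $\zeta_R(s)=\zeta_R(s;\delta)=\int_0^\delta t^{s-1}R(t)\,dt$. Both functions are identified with their analytic continuations. Write $\mathbb H_\sigma=\{s\in\mathbb C:\operatorname{Re}s>\sigma\}$. *Definitions.* A *screen* is a bounded Lipschitz function $S:\mathbb R\to\mathbb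 R$, identified with $\{S(\tau)+i\tau:\tau\in\mathbb R\}$; its *window* is $W=\{s:\operatorname{Re}s\ge S(\operatorname{Im}s)\}$. A *sequence of admissible heights* is a sequence $(\tau_n)_{n\in\mathbb Z}$ of reals with $\tau_n\to\pm\infty$ as $n\to\pm\infty$ and $\tau_{-n}<0<\tau_n$ for $n\ge1$. Two functions $f,g$ that are holomorphic in a common right half-plane are *jointly languid* (with exponent $\kappa=0$) on the screen $S$ if $S$ lies in the largest open right half-plane to which both continue analytically up to a discrete set of singularities, and there is one sequence of admissible heights $(\tau_n)$ such that, for each $h\in\{f,g\}$: * $h$ is holomorphic in some $\mathbb H_D\subseteq W$ and continues analytically to a neighbourhood of $W$, except for a discrete set of singularities, none of which lies on $S$; * (L1) for some $C>0$ and $\beta>D$, every segment $[S(\tau_n)+i\tau_n,\ \beta+i\tau_n]$, $n\in\mathbb Z$, contains no singularity of $h$, and $|h|\le C$ on it; * (L2) for some $C>0$, $|h(S(\tau)+i\tau)|\le C$ for all real $\tau$ with $|\tau|\ge1$. The function $R$ is an *admissible remainder* for $\Phi$ if the integral $\zeta_R$ converges and is holomorphic in some right half-plane and there is a screen $S$ on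 which $\zeta_\Phi$ and $\zeta_R$ are jointly languid; every such $S$ is called an *admissible screen*. *Theorem.* Let $R:(0,\infty)\to\mathbb R$ be continuous and let $\sigma_0<D_\ell$ be a real number with $R(t)=O(t^{-\sigma_0})$ as $t\to0^+$. Then, for every $\delta>0$, $R$ is an admissible remainder for $\Phi$, and for every $\varepsilon$ with $0<\varepsilon<D_\ell-\sigma_0$ the constant screen $S_\varepsilon(\tau)\equiv\sigma_0+\varepsilon$ is admissible. -/

import Mathlib

open Set Filter Topology Asymptotics

noncomputable section

/-! ### Self-similar systems -/

/-- A self-similar system on a metric space: a nonempty finite set of contractive similitudes.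
Mathlib's `Dilation`s are the maps with `dist (φ x) (φ y) = r * dist x y` for some `r > 0`;
`Dilation.ratio φ` is this scaling ratio `r` as soon as `X` has two points. (It is `1` on a space
with at most one point, where a scaling ratio is not determined; such spaces carry no system.) -/
structure SelfSimilarSystem (X : Type*) [MetricSpace X] where
  maps : Finset (X →ᵈ X)
  nonempty : maps.Nonempty
  ratio_lt_one : ∀ φ ∈ maps, Dilation.ratio φ < 1

/-! ### Scaling operators and their zeta functions -/

/-- A scaling operator `∑ a_k M_{λ_k}`, `M_λ[f](x) = f (x / λ)`, given by the finitely supported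
function `λ_k ↦ a_k` on the positive reals. -/
abbrev ScalingOperator : Type := {r : ℝ // 0 < r} →₀ ℝ

/-- The action `L[f](x) = ∑ a_k f (x / λ_k)`. -/
def ScalingOperator.apply (L : ScalingOperator) (f : ℝ → ℝ) (x : ℝ) : ℝ :=
  L.sum fun r a => a * f (x / r.1)

/-- The scaling zeta function `1 / (1 - ∑ a_k λ_k ^ s)`. (At a zero of the denominator Lean's value
is `0`; such points have to be treated as singularities wherever this function is used.) -/
def ScalingOperator.zeta (L : ScalingOperator) (s : ℂ) : ℂ :=
  1 / (1 - L.sum fun r a => (a : ℂ) * ((r.1 : ℝ) : ℂ) ^ s)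

namespace SelfSimilarSystem

variable {X : Type*} [MetricSpace X] (Φ : SelfSimilarSystem X)

/-- The scaling operator `L_Φ = ∑_{φ ∈ Φ} M_{λ_φ}`. -/
def scalingOperator : ScalingOperator :=
  ∑ φ ∈ Φ.maps, Finsupp.single ⟨(Dilation.ratio φ : ℝ), by exact_mod_cast Dilation.ratio_pos φ⟩ 1

/-- The set of distinct scaling ratios `r_1 > ... > r_M`. -/
def ratios : Finset ℝ := Φ.maps.image fun φ => (Dilation.ratio φ : ℝ)

/-- The multiplicity of a scaling ratio. -/
def mult (r : ℝ) : ℕ := (Φ.maps.filter fun φ => (Dilation.ratio φ : ℝ) = r).card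

/-- The smallest scaling ratio `r_M`. -/
def minRatio : ℝ := Φ.ratios.min' (Φ.nonempty.image _)

/-- The function
`p(t) = (1 / m_M) (1 / r_M) ^ t + ∑_{k < M} (m_k / m_M) (r_k / r_M) ^ t`. -/
def lowerPoly (t : ℝ) : ℝ :=
  1 / (Φ.mult Φ.minRatio : ℝ) * (Φ.minRatio⁻¹) ^ t +
    ∑ r ∈ Φ.ratios.erase Φ.minRatio,
      (Φ.mult r : ℝ) / (Φ.mult Φ.minRatio : ℝ) * (r / Φ.minRatio) ^ t

theorem minRatio_mem : Φ.minRatio ∈ Φ.ratios := Finset.min'_mem _ _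

theorem ratios_pos {r : ℝ} (hr : r ∈ Φ.ratios) : 0 < r := by
  obtain ⟨φ, -, rfl⟩ := Finset.mem_image.1 hr
  exact_mod_cast Dilation.ratio_pos φ

theorem ratios_lt_one {r : ℝ} (hr : r ∈ Φ.ratios) : r < 1 := by
  obtain ⟨φ, hφ, rfl⟩ := Finset.mem_image.1 hr
  exact_mod_cast Φ.ratio_lt_one φ hφ

theorem mult_pos {r : ℝ} (hr : r ∈ Φ.ratios) : 0 < Φ.mult r := by
  obtain ⟨φ, hφ, rfl⟩ := Finset.mem_image.1 hr
  exact Finset.card_pos.2 ⟨φ, Finset.mem_filter.2 ⟨hφ, rfl⟩⟩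

theorem one_lt_div_minRatio {r : ℝ} (hr : r ∈ Φ.ratios.erase Φ.minRatio) :
    1 < r / Φ.minRatio := by
  rw [one_lt_div (Φ.ratios_pos Φ.minRatio_mem)]
  exact lt_of_le_of_ne (Finset.min'_le _ _ (Finset.mem_of_mem_erase hr))
    (Finset.ne_of_mem_erase hr).symm

theorem one_lt_inv_minRatio : 1 < Φ.minRatio⁻¹ :=
  (one_lt_inv₀ (Φ.ratios_pos Φ.minRatio_mem)).2 (Φ.ratios_lt_one Φ.minRatio_mem)

/-- The defining equation of the lower similarity dimension has exactly one real solution. -/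
theorem existsUnique_lowerPoly_eq_one : ∃! t : ℝ, Φ.lowerPoly t = 1 := by
  have hm : (0 : ℝ) < 1 / (Φ.mult Φ.minRatio : ℝ) :=
    one_div_pos.2 (by exact_mod_cast Φ.mult_pos Φ.minRatio_mem)
  have hb := Φ.one_lt_inv_minRatio
  have hmono : StrictMono Φ.lowerPoly := by
    intro x y hxy
    refine add_lt_add_of_lt_of_le
      (mul_lt_mul_of_pos_left (Real.rpow_lt_rpow_of_exponent_lt hb hxy) hm)
      (Finset.sum_le_sum fun r hr => mul_le_mul_of_nonneg_left
        (Real.rpow_le_rpow_of_exponent_le (Φ.one_lt_div_minRatio hr).le hxy.le) (by positivity))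
  have hcont : Continuous Φ.lowerPoly := by
    refine Continuous.add (continuous_const.mul (Real.continuous_const_rpow (by positivity)))
      (continuous_finsetSum _ fun r hr => continuous_const.mul
        (Real.continuous_const_rpow (by linarith [Φ.one_lt_div_minRatio hr])))
  have htop : Tendsto Φ.lowerPoly atTop atTop := by
    refine tendsto_atTop_mono (fun t => ?_)
      ((tendsto_rpow_atTop_of_base_gt_one _ hb).const_mul_atTop hm)
    refine le_add_of_nonneg_right (Finset.sum_nonneg fun r hr => ?_)
    have := (zero_lt_one.trans (Φ.one_lt_div_minRatio hr)).le
    positivity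
  have hbot : Tendsto Φ.lowerPoly atBot (𝓝 0) := by
    have h := ((tendsto_rpow_atBot_of_base_gt_one _ hb).const_mul
        (1 / (Φ.mult Φ.minRatio : ℝ))).add
      (tendsto_finsetSum (Φ.ratios.erase Φ.minRatio) fun r hr =>
        (tendsto_rpow_atBot_of_base_gt_one _ (Φ.one_lt_div_minRatio hr)).const_mul
          ((Φ.mult r : ℝ) / (Φ.mult Φ.minRatio : ℝ)))
    simp only [mul_zero, Finset.sum_const_zero, add_zero] at h
    exact h
  obtain ⟨a, ha⟩ := (hbot.eventually_le_const zero_lt_one).exists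
  obtain ⟨b, hb'⟩ := (htop.eventually_ge_atTop 1).exists
  obtain ⟨t, ht⟩ := mem_range_of_exists_le_of_exists_ge hcont ⟨a, ha⟩ ⟨b, hb'⟩
  exact ⟨t, ht, fun y hy => hmono.injective (hy.trans ht.symm)⟩

/-- The lower similarity dimension `D_ℓ` of a self-similar system: the unique real solution of
`p(D_ℓ) = 1`. -/
def lowerSimDim : ℝ := Φ.existsUnique_lowerPoly_eq_one.choose

theorem lowerPoly_lowerSimDim : Φ.lowerPoly Φ.lowerSimDim = 1 :=
  Φ.existsUnique_lowerPoly_eq_one.choose_spec.1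

end SelfSimilarSystem

/-! ### Truncated Mellin transforms -/

/-- `R` times the characteristic function of `(0, δ]`, with complex values. -/
def truncate (R : ℝ → ℝ) (δ : ℝ) : ℝ → ℂ := (Ioc 0 δ).indicator fun t => (R t : ℂ)

/-- The truncated Mellin transform `ζ_R(s; δ) = ∫_0^δ t ^ (s - 1) R(t) dt`. -/
def remainderZeta (R : ℝ → ℝ) (δ : ℝ) (s : ℂ) : ℂ := mellin (truncate R δ) s

/-! ### Half-planes, screens, windows, analytic continuation -/

/-- The open right half-plane `Re s > σ`; `σ = ⊥` gives the whole plane. -/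
def halfPlane (σ : EReal) : Set ℂ := {s | σ < (s.re : EReal)}

/-- A screen is (the graph of) a bounded Lipschitz function `S : ℝ → ℝ`. -/
def IsScreen (S : ℝ → ℝ) : Prop :=
  (∃ M : ℝ, ∀ τ, |S τ| ≤ M) ∧ ∃ K : NNReal, LipschitzWith K S

/-- The point `S(τ) + iτ` of a screen. -/
def screenPoint (S : ℝ → ℝ) (τ : ℝ) : ℂ := ⟨S τ, τ⟩

/-- The window `Re s ≥ S(Im s)` of a screen. -/
def window (S : ℝ → ℝ) : Set ℂ := {s | S s.im ≤ s.re}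

/-- `F` is an analytic continuation to the open set `U`, except for a discrete set `P` of singular
points, of the function `f`, which is holomorphic in the half-plane `Re s > D`. -/
structure IsContinuation (f : ℂ → ℂ) (D : ℝ) (U : Set ℂ) (F : ℂ → ℂ) (P : Set ℂ) : Prop where
  isOpen : IsOpen U
  holomorphic : DifferentiableOn ℂ f (halfPlane D)
  eqOn : EqOn F f (halfPlane D)
  discrete : ∀ z ∈ U, ¬ AccPt z (𝓟 P)
  differentiableOn : DifferentiableOn ℂ F (U \ P)

/-- `F`, with singular set `P`, is an extension with respect to the screen `S` of the function `f`,
which is holomorphic in the half-plane `Re s > D`: it is a continuation of `f` to a neighbourhood of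
the window of `S`, the window contains the half-plane, and no singular point lies on the screen. -/
def IsScreenExtension (f : ℂ → ℂ) (D : ℝ) (S : ℝ → ℝ) (F : ℂ → ℂ) (P : Set ℂ) : Prop :=
  (∃ U, window S ⊆ U ∧ IsContinuation f D U F P) ∧ halfPlane D ⊆ window S ∧
    ∀ τ, screenPoint S τ ∉ P

/-! ### Languid growth -/

/-- Sequences of admissible heights. -/
def AdmissibleHeights (T : ℤ → ℝ) : Prop :=
  Tendsto T atTop atTop ∧ Tendsto T atBot atBot ∧ ∀ n : ℤ, 1 ≤ n → T (-n) < 0 ∧ 0 < T n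

/-- Languidity hypothesis L1 for `f` with exponent `κ` with respect to the screen `S`, using the
sequence of admissible heights `T`: the extension of `f` has no singular point on the segments
`[S(T_n) + i T_n, β + i T_n]`, and is bounded by `C (|T_n| + 1) ^ κ` there. -/
def LanguidL1 (f : ℂ → ℂ) (κ : ℝ) (S : ℝ → ℝ) (T : ℤ → ℝ) : Prop :=
  AdmissibleHeights T ∧
  ∃ (D : ℝ) (F : ℂ → ℂ) (P : Set ℂ), IsScreenExtension f D S F P ∧
    ∃ C > 0, ∃ β > D, ∀ n : ℤ, ∀ σ ∈ Icc (S (T n)) β,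
      (⟨σ, T n⟩ : ℂ) ∉ P ∧ ‖F ⟨σ, T n⟩‖ ≤ C * (|T n| + 1) ^ κ

/-- Languidity hypothesis L2 for `f` with exponent `κ` with respect to the screen `S`. -/
def LanguidL2 (f : ℂ → ℂ) (κ : ℝ) (S : ℝ → ℝ) : Prop :=
  ∃ (D : ℝ) (F : ℂ → ℂ) (P : Set ℂ), IsScreenExtension f D S F P ∧
    ∃ C > 0, ∀ τ : ℝ, 1 ≤ |τ| → ‖F (screenPoint S τ)‖ ≤ C * |τ| ^ κ

/-- `f` admits an analytic continuation to the half-plane `Re s > σ`, except perhaps for a discrete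
set of singular points. -/
def ExtendsToHalfPlane (f : ℂ → ℂ) (σ : EReal) : Prop :=
  ∃ (D : ℝ) (F : ℂ → ℂ) (P : Set ℂ), IsContinuation f D (halfPlane σ) F P

/-- The abscissa of the half-plane of maximal joint extension of `f` and `g`, that is, of the
largest half-plane to which both functions extend. (By uniqueness of analytic continuation the
infimum is attained as soon as the set is nonempty; it is `⊤` otherwise.) -/
def jointAbscissa (f g : ℂ → ℂ) : EReal :=
  sInf {σ : EReal | σ < ⊤ ∧ ExtendsToHalfPlane f σ ∧ ExtendsToHalfPlane g σ}

/-- `f` and `g` are jointly languid with exponent `κ` with respect to the screen `S`. -/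
structure JointlyLanguidOn (f g : ℂ → ℂ) (κ : ℝ) (S : ℝ → ℝ) : Prop where
  holomorphic : ∃ σ₁ : ℝ,
    DifferentiableOn ℂ f (halfPlane σ₁) ∧ DifferentiableOn ℂ g (halfPlane σ₁)
  isScreen : IsScreen S
  mem_halfPlane : ∀ τ, screenPoint S τ ∈ halfPlane (jointAbscissa f g)
  languidL1 : ∃ T : ℤ → ℝ, LanguidL1 f κ S T ∧ LanguidL1 g κ S T
  languidL2 : LanguidL2 f κ S ∧ LanguidL2 g κ S

/-! ### Admissible remainders and screens -/

/-- `S` is an admissible screen for the remainder `R` and the scaling operator `L`: the integral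
`ζ_R(·; δ)` converges and is holomorphic in some half-plane, and `ζ_L` and `ζ_R(·; δ)` are jointly
languid with exponent `0` with respect to `S`. -/
def IsAdmissibleScreen (L : ScalingOperator) (R : ℝ → ℝ) (δ : ℝ) (S : ℝ → ℝ) : Prop :=
  (∃ σ : ℝ, (∀ s ∈ halfPlane σ, MellinConvergent (truncate R δ) s) ∧
    DifferentiableOn ℂ (remainderZeta R δ) (halfPlane σ)) ∧
  JointlyLanguidOn L.zeta (remainderZeta R δ) 0 S

/-- `R` is an admissible remainder for the scaling operator `L`. -/
def IsAdmissibleRemainder (L : ScalingOperator) (R : ℝ → ℝ) (δ : ℝ) : Prop :=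
  ∃ S : ℝ → ℝ, IsAdmissibleScreen L R δ S

end

/-!
The denominator of `ζ_Φ` is an exponential polynomial with finitely many frequencies. For
`Re s ≤ b < D_ℓ` the term of the smallest ratio exceeds the sum of the absolute values of all the
others, with a gap bounded below in terms of `b`; this bounds `ζ_Φ` on the screen. For the
horizontal segments, choose one height without zeros and translate it vertically. Translation by
`n` multiplies each term by the `n`-th power of a fixed phase, and in the compact group of phases
these powers return arbitrarily close to `1` as `n → ∞` and as `n → -∞`; since the segment is
compact, the denominator stays bounded away from zero on it along such `n`. The function `ζ_R` is a
Mellin transform converging absolutely for `Re s > σ₀`, hence holomorphic there and bounded on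
closed vertical strips of finite width.
-/

open MeasureTheory Complex

/-! ### The denominator of the scaling zeta function -/

namespace ScalingOperator

/-- The exponential polynomial `1 - ∑ a_k λ_k ^ s`, whose reciprocal is the scaling zeta
function. -/
noncomputable def zetaDenom (L : ScalingOperator) (s : ℂ) : ℂ :=
  1 - L.sum fun r a => (a : ℂ) * ((r.1 : ℝ) : ℂ) ^ s

/-- The exponential polynomial `1 - ∑ a_k χ(λ_k) λ_k ^ s`, whose terms are rotated by the phases
`χ`. The vertical translates of `zetaDenom` are of this form, and the phases form a compact
group. -/
noncomputable def twistedZetaDenom (L : ScalingOperator) (χ : {r : ℝ // 0 < r} → Circle) (s : ℂ) :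
    ℂ :=
  1 - L.sum fun r a => (a : ℂ) * (χ r * ((r.1 : ℝ) : ℂ) ^ s)

/-- The phases `r ^ I` by which the translation `s ↦ s + I` rotates the terms of the exponential
polynomial. -/
noncomputable def translationPhase (r : {r : ℝ // 0 < r}) : Circle := Circle.exp (Real.log r)

variable (L : ScalingOperator)

theorem zeta_eq_inv_zetaDenom (s : ℂ) : L.zeta s = (L.zetaDenom s)⁻¹ := one_div _

theorem norm_zeta_le {c : ℝ} (hc : 0 < c) {s : ℂ} (h : c ≤ ‖L.zetaDenom s‖) :
    ‖L.zeta s‖ ≤ c⁻¹ := by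
  rw [zeta_eq_inv_zetaDenom, norm_inv]
  exact inv_anti₀ hc h

theorem twistedZetaDenom_one : L.twistedZetaDenom 1 = L.zetaDenom := by
  ext s
  simp [twistedZetaDenom, zetaDenom]

theorem zetaDenom_add_intCast_mul_I (s : ℂ) (n : ℤ) :
    L.zetaDenom (s + n * I) = L.twistedZetaDenom (translationPhase ^ n) s := by
  refine congrArg (1 - ·) (Finset.sum_congr rfl fun r _ => ?_)
  have hr : (r.1 : ℂ) ≠ 0 := ofReal_ne_zero.2 r.2.ne'
  have hphase : (r.1 : ℂ) ^ (n * I) = (translationPhase r : ℂ) ^ n := by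
    rw [translationPhase, Circle.coe_exp, ← exp_int_mul, cpow_def_of_ne_zero hr, ofReal_log r.2.le]
    ring_nf
  dsimp only
  rw [cpow_add _ _ hr, hphase, mul_comm ((r.1 : ℂ) ^ s), Pi.pow_apply, Circle.coe_zpow]

theorem differentiable_zetaDenom : Differentiable ℂ L.zetaDenom :=
  (differentiable_const _).sub <| Differentiable.fun_sum fun r _ =>
    (differentiable_const _).mul <|
      differentiable_id.const_cpow <| Or.inl <| ofReal_ne_zero.2 r.2.ne'

theorem continuous_twistedZetaDenom :
    Continuous fun p : ({r : ℝ // 0 < r} → Circle) × ℂ => L.twistedZetaDenom p.1 p.2 := by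
  refine continuous_const.sub (continuous_finsetSum _ fun r _ => continuous_const.mul ?_)
  have hphase : Continuous fun p : ({r : ℝ // 0 < r} → Circle) × ℂ => (p.1 r : ℂ) := by fun_prop
  exact hphase.mul (continuous_snd.const_cpow (Or.inl (ofReal_ne_zero.2 r.2.ne')))

theorem compl_zeros_zetaDenom_mem_codiscrete {s₀ : ℂ} (hs₀ : L.zetaDenom s₀ ≠ 0) :
    {s | L.zetaDenom s = 0}ᶜ ∈ codiscrete ℂ :=
  AnalyticOnNhd.preimage_zero_mem_codiscrete
    (fun z _ => L.differentiable_zetaDenom.analyticAt z) hs₀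

theorem eventually_zetaDenom_ne_zero (hL : ∀ r ∈ L.support, r.1 < 1) :
    ∀ᶠ D : ℝ in atTop, ∀ s : ℂ, D < s.re → L.zetaDenom s ≠ 0 := by
  have hlim : Tendsto (fun σ : ℝ => L.sum fun r a => |a| * r.1 ^ σ) atTop (𝓝 0) := by
    have hterm := tendsto_finsetSum L.support fun r hr =>
      (tendsto_rpow_atTop_of_base_lt_one r.1 (by linarith [r.2]) (hL r hr)).const_mul |L r|
    simpa [Finsupp.sum] using hterm
  obtain ⟨D₀, hD₀⟩ := eventually_atTop.1 (hlim.eventually_lt_const zero_lt_one)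
  filter_upwards [eventually_ge_atTop D₀] with D hD s hs hzero
  have hsum : ‖L.sum fun r a => (a : ℂ) * (r.1 : ℂ) ^ s‖ < 1 := by
    refine (norm_sum_le _ _).trans_lt ?_
    simp only [norm_mul, norm_real, Real.norm_eq_abs,
      fun r : {r : ℝ // 0 < r} => norm_cpow_eq_rpow_re_of_pos r.2]
    exact hD₀ s.re (hD.trans hs.le)
  rw [← sub_eq_zero.1 hzero, norm_one] at hsum
  exact hsum.false

end ScalingOperator

/-! ### Admissible heights -/

theorem exists_horizontal_line_disjoint {P : Set ℂ} (hP : Pᶜ ∈ codiscrete ℂ) :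
    ∃ τ : ℝ, ∀ s ∈ P, s.im ≠ τ := by
  have hcount : P.Countable :=
    (HereditarilyLindelofSpace.isLindelof P).countable_of_isDiscrete
      (compl_mem_codiscrete_iff.1 hP).2
  obtain ⟨τ, hτ⟩ : (im '' P)ᶜ.Nonempty := by
    rw [nonempty_compl]
    exact fun h => not_countable_univ (h ▸ hcount.image im)
  exact ⟨τ, fun s hs hsτ => hτ ⟨s, hs, hsτ⟩⟩

theorem exists_admissibleHeights_of_frequently {p : ℝ → Prop} (htop : ∃ᶠ t in atTop, p t)
    (hbot : ∃ᶠ t in atBot, p t) : ∃ T : ℤ → ℝ, AdmissibleHeights T ∧ ∀ n, p (T n) := by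
  choose u hu hpu using frequently_atTop'.1 htop
  choose d hd hpd using frequently_atBot'.1 hbot
  refine ⟨fun n => if 0 ≤ n then u n else d n, ⟨?_, ?_, fun n hn => ?_⟩, fun n => ?_⟩
  · refine tendsto_atTop_mono' _ ?_ tendsto_intCast_atTop_atTop
    filter_upwards [eventually_ge_atTop 0] with n hn
    simpa only [if_pos hn] using (hu n).le
  · refine tendsto_atBot_mono' _ ?_ (tendsto_intCast_atBot_iff.2 tendsto_id)
    filter_upwards [eventually_lt_atBot 0] with n hn
    simpa only [if_neg hn.not_ge, id] using (hd n).le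
  · have hn' : (0 : ℝ) < n := by exact_mod_cast hn
    simp only [if_neg (show ¬ 0 ≤ -n by lia), if_pos (show 0 ≤ n by lia)]
    exact ⟨(hd _).trans (by simpa using hn'), hn'.trans (hu _)⟩
  · dsimp only
    split_ifs
    exacts [hpu n, hpd n]

section Recurrence

variable {G : Type*} [Group G] [TopologicalSpace G] [CompactSpace G] [IsTopologicalGroup G]

theorem mapClusterPt_one_atTop_zpow (x : G) : MapClusterPt 1 atTop fun n : ℤ => x ^ n :=
  mapClusterPt_atTop_zpow_iff_pow.2 (mapClusterPt_one_atTop_pow x)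

theorem mapClusterPt_one_atBot_zpow (x : G) : MapClusterPt 1 atBot fun n : ℤ => x ^ n := by
  refine MapClusterPt.of_comp tendsto_neg_atTop_atBot ?_
  simpa only [Function.comp_def, zpow_neg, inv_zpow] using mapClusterPt_one_atTop_zpow x⁻¹

end Recurrence

namespace ScalingOperator

variable (L : ScalingOperator)

theorem exists_eventually_forall_le_norm_twistedZetaDenom {K : Set ℂ} (hK : IsCompact K)
    (hKL : ∀ s ∈ K, L.zetaDenom s ≠ 0) :
    ∃ c > 0, ∀ᶠ χ in 𝓝 (1 : {r : ℝ // 0 < r} → Circle), ∀ s ∈ K,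
      c ≤ ‖L.twistedZetaDenom χ s‖ := by
  obtain ⟨c, hc, hcK⟩ : ∃ c > 0, ∀ s ∈ K, c ≤ ‖L.zetaDenom s‖ :=
    hK.exists_forall_le' L.differentiable_zetaDenom.continuous.norm.continuousOn
      fun s hs => norm_pos_iff.2 (hKL s hs)
  refine ⟨c / 2, half_pos hc, hK.eventually_forall_of_forall_eventually fun s hs => ?_⟩
  have hs' : c / 2 < ‖L.twistedZetaDenom 1 s‖ := by
    rw [twistedZetaDenom_one]
    exact (half_lt_self hc).trans_le (hcK s hs)
  have hcont : ContinuousAt (fun p : ({r : ℝ // 0 < r} → Circle) × ℂ =>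
      ‖L.twistedZetaDenom p.1 p.2‖) (1, s) := L.continuous_twistedZetaDenom.norm.continuousAt
  exact (hcont.eventually_const_lt hs').mono fun _ => le_of_lt

theorem exists_frequently_forall_le_norm_zetaDenom_add_intCast_mul_I {K : Set ℂ}
    (hK : IsCompact K) (hKL : ∀ s ∈ K, L.zetaDenom s ≠ 0) :
    ∃ c > 0, (∃ᶠ n : ℤ in atTop, ∀ s ∈ K, c ≤ ‖L.zetaDenom (s + n * I)‖) ∧
      ∃ᶠ n : ℤ in atBot, ∀ s ∈ K, c ≤ ‖L.zetaDenom (s + n * I)‖ := by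
  obtain ⟨c, hc, hχ⟩ := L.exists_eventually_forall_le_norm_twistedZetaDenom hK hKL
  simp only [zetaDenom_add_intCast_mul_I]
  exact ⟨c, hc, (mapClusterPt_one_atTop_zpow translationPhase).frequently hχ,
    (mapClusterPt_one_atBot_zpow translationPhase).frequently hχ⟩

theorem exists_admissibleHeights_le_norm_zetaDenom {s₀ : ℂ} (hs₀ : L.zetaDenom s₀ ≠ 0)
    (a b : ℝ) :
    ∃ T : ℤ → ℝ, AdmissibleHeights T ∧
      ∃ c > 0, ∀ n : ℤ, ∀ σ ∈ Icc a b, c ≤ ‖L.zetaDenom ⟨σ, T n⟩‖ := by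
  obtain ⟨τ, hτ⟩ := exists_horizontal_line_disjoint (L.compl_zeros_zetaDenom_mem_codiscrete hs₀)
  have hsegment : IsCompact ((fun σ : ℝ => (⟨σ, τ⟩ : ℂ)) '' Icc a b) := by
    refine isCompact_Icc.image ?_
    simp only [mk_eq_add_mul_I]
    fun_prop
  obtain ⟨c, hc, htop, hbot⟩ :=
    L.exists_frequently_forall_le_norm_zetaDenom_add_intCast_mul_I hsegment <| by
      rintro _ ⟨σ, -, rfl⟩ hzero
      exact hτ _ hzero rfl
  have hheight (σ : ℝ) (n : ℤ) : (⟨σ, τ⟩ : ℂ) + n * I = ⟨σ, τ + n⟩ := by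
    apply Complex.ext <;> simp
  simp only [forall_mem_image, hheight] at htop hbot
  obtain ⟨T, hT, hTc⟩ := exists_admissibleHeights_of_frequently
    (p := fun t => ∀ σ ∈ Icc a b, c ≤ ‖L.zetaDenom ⟨σ, t⟩‖)
    ((tendsto_atTop_add_const_left _ τ tendsto_intCast_atTop_atTop).frequently htop)
    ((tendsto_atBot_add_const_left _ τ (tendsto_intCast_atBot_iff.2 tendsto_id)).frequently hbot)
  exact ⟨T, hT, c, hc, hTc⟩

end ScalingOperator

/-! ### Screens -/

theorem mem_halfPlane_coe {σ : ℝ} {s : ℂ} : s ∈ halfPlane σ ↔ σ < s.re :=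
  EReal.coe_lt_coe_iff

theorem isOpen_halfPlane (σ : EReal) : IsOpen (halfPlane σ) :=
  isOpen_lt continuous_const (continuous_coe_real_ereal.comp continuous_re)

theorem halfPlane_subset_window {S : ℝ → ℝ} {D : ℝ} (hSD : ∀ τ, S τ ≤ D) :
    halfPlane D ⊆ window S := fun s hs =>
  (hSD s.im).trans (mem_halfPlane_coe.1 hs).le

theorem window_subset_halfPlane {S : ℝ → ℝ} {σ : ℝ} (hS : ∀ τ, σ < S τ) :
    window S ⊆ halfPlane σ := fun s hs =>
  mem_halfPlane_coe.2 ((hS s.im).trans_le hs)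

theorem isScreen_const (a : ℝ) : IsScreen fun _ => a :=
  ⟨⟨|a|, fun _ => le_rfl⟩, 0, LipschitzWith.const a⟩

namespace IsScreenExtension

variable {f F : ℂ → ℂ} {D C : ℝ} {S : ℝ → ℝ} {P : Set ℂ}

theorem languidL1 (h : IsScreenExtension f D S F P) {T : ℤ → ℝ} (hT : AdmissibleHeights T)
    {β : ℝ} (hβ : D < β) (hC : 0 < C)
    (hFC : ∀ n, ∀ σ ∈ Icc (S (T n)) β, (⟨σ, T n⟩ : ℂ) ∉ P ∧ ‖F ⟨σ, T n⟩‖ ≤ C) :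
    LanguidL1 f 0 S T :=
  ⟨hT, D, F, P, h, C, hC, β, hβ, by simpa only [Real.rpow_zero, mul_one] using hFC⟩

theorem languidL2 (h : IsScreenExtension f D S F P) (hC : 0 < C)
    (hFC : ∀ τ, ‖F (screenPoint S τ)‖ ≤ C) : LanguidL2 f 0 S :=
  ⟨D, F, P, h, C, hC, fun τ _ => by simpa only [Real.rpow_zero, mul_one] using hFC τ⟩

end IsScreenExtension

/-! ### Languidity of the scaling zeta function -/

namespace ScalingOperator

variable {L : ScalingOperator} {S : ℝ → ℝ}

theorem isContinuation_zeta {D : ℝ} (hD : ∀ s : ℂ, D < s.re → L.zetaDenom s ≠ 0) {U : Set ℂ}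
    (hU : IsOpen U) : IsContinuation L.zeta D U L.zeta {s | L.zetaDenom s = 0} := by
  have hdiff : DifferentiableOn ℂ L.zeta {s | L.zetaDenom s = 0}ᶜ := by
    rw [funext L.zeta_eq_inv_zetaDenom]
    exact L.differentiable_zetaDenom.differentiableOn.inv fun _ => id
  have hcodiscrete :=
    L.compl_zeros_zetaDenom_mem_codiscrete (hD ((D + 1 : ℝ) : ℂ) (lt_add_one D))
  exact
    { isOpen := hU
      holomorphic := hdiff.mono fun s hs => hD s (mem_halfPlane_coe.1 hs)
      eqOn := eqOn_refl _ _
      discrete := fun z _ => by simpa using mem_codiscrete_accPt.1 hcodiscrete z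
      differentiableOn := hdiff.mono fun s hs => hs.2 }

theorem extendsToHalfPlane_zeta (hL : ∀ r ∈ L.support, r.1 < 1) (σ : EReal) :
    ExtendsToHalfPlane L.zeta σ := by
  obtain ⟨D, hD⟩ := (L.eventually_zetaDenom_ne_zero hL).exists
  exact ⟨D, _, _, isContinuation_zeta hD (isOpen_halfPlane σ)⟩

theorem exists_isScreenExtension_zeta (hL : ∀ r ∈ L.support, r.1 < 1) (hS : IsScreen S)
    (hSL : ∀ τ, L.zetaDenom (screenPoint S τ) ≠ 0) :
    ∃ D, IsScreenExtension L.zeta D S L.zeta {s | L.zetaDenom s = 0} := by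
  obtain ⟨M, hM⟩ := hS.1
  obtain ⟨D, hD, hMD⟩ := ((L.eventually_zetaDenom_ne_zero hL).and (eventually_ge_atTop M)).exists
  exact ⟨D, ⟨univ, subset_univ _, isContinuation_zeta hD isOpen_univ⟩,
    halfPlane_subset_window fun τ => (le_of_abs_le (hM τ)).trans hMD, hSL⟩

theorem exists_languidL1_zeta (hL : ∀ r ∈ L.support, r.1 < 1) (hS : IsScreen S)
    (hSL : ∀ τ, L.zetaDenom (screenPoint S τ) ≠ 0) :
    ∃ T, AdmissibleHeights T ∧ LanguidL1 L.zeta 0 S T := by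
  obtain ⟨D, hext⟩ := exists_isScreenExtension_zeta hL hS hSL
  obtain ⟨M, hM⟩ := hS.1
  obtain ⟨T, hT, c, hc, hTc⟩ := L.exists_admissibleHeights_le_norm_zetaDenom (hSL 0) (-M) (D + 1)
  refine ⟨T, hT, hext.languidL1 hT (lt_add_one D) (inv_pos.2 hc) fun n σ hσ => ?_⟩
  have hle := hTc n σ ⟨(neg_le_of_abs_le (hM _)).trans hσ.1, hσ.2⟩
  exact ⟨norm_pos_iff.1 (hc.trans_le hle), L.norm_zeta_le hc hle⟩

theorem languidL2_zeta (hL : ∀ r ∈ L.support, r.1 < 1) (hS : IsScreen S) {c : ℝ} (hc : 0 < c)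
    (hSc : ∀ τ, c ≤ ‖L.zetaDenom (screenPoint S τ)‖) : LanguidL2 L.zeta 0 S := by
  obtain ⟨D, hext⟩ :=
    exists_isScreenExtension_zeta hL hS fun τ => norm_pos_iff.1 (hc.trans_le (hSc τ))
  exact hext.languidL2 (inv_pos.2 hc) fun τ => L.norm_zeta_le hc (hSc τ)

end ScalingOperator

/-! ### Languidity of the truncated Mellin transform -/

theorem norm_mellin_le_of_re_mem_Icc {E : Type*} [NormedAddCommGroup E] [NormedSpace ℂ E]
    {f : ℝ → E} {a b : ℝ} (ha : MellinConvergent f a) (hb : MellinConvergent f b) {s : ℂ}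
    (hs : s.re ∈ Icc a b) :
    ‖mellin f s‖ ≤
      ∫ t in Ioi (0 : ℝ), (‖(t : ℂ) ^ ((a : ℂ) - 1) • f t‖ + ‖(t : ℂ) ^ ((b : ℂ) - 1) • f t‖) := by
  refine norm_integral_le_of_norm_le (ha.norm.add hb.norm) ?_
  filter_upwards [ae_restrict_mem measurableSet_Ioi] with t (ht : 0 < t)
  simp only [norm_smul, norm_cpow_eq_rpow_re_of_pos ht, sub_re, ofReal_re, one_re, ← add_mul]
  refine mul_le_mul_of_nonneg_right ?_ (norm_nonneg _)
  rcases le_total t 1 with ht1 | ht1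
  · exact (Real.rpow_le_rpow_of_exponent_ge ht ht1 (sub_le_sub_right hs.1 1)).trans
      (le_add_of_nonneg_right (Real.rpow_nonneg ht.le _))
  · exact (Real.rpow_le_rpow_of_exponent_le ht1 (sub_le_sub_right hs.2 1)).trans
      (le_add_of_nonneg_left (Real.rpow_nonneg ht.le _))

section Remainder

variable {R : ℝ → ℝ} {σ₀ δ D : ℝ} {S : ℝ → ℝ}

theorem locallyIntegrableOn_truncate (hR : LocallyIntegrableOn R (Ioi 0)) :
    LocallyIntegrableOn (truncate R δ) (Ioi 0) := fun t ht =>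
  let ⟨u, hu, hRu⟩ := hR t ht
  ⟨u, hu, hRu.ofReal.indicator measurableSet_Ioc⟩

theorem truncate_isBigO_atTop (g : ℝ → ℝ) : truncate R δ =O[atTop] g := by
  refine EventuallyEq.trans_isBigO ?_ (isBigO_zero _ _)
  filter_upwards [eventually_gt_atTop δ] with t ht
  exact indicator_of_notMem (fun h => ht.not_ge h.2) _

theorem truncate_isBigO (l : Filter ℝ) : truncate R δ =O[l] R :=
  isBigO_of_le l fun t =>
    (norm_indicator_le_norm_self _ _).trans (norm_real (R t)).le

theorem mellinConvergent_truncate (hR : LocallyIntegrableOn R (Ioi 0))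
    (hRO : R =O[𝓝[>] 0] fun t : ℝ => t ^ (-σ₀)) {s : ℂ} (hs : σ₀ < s.re) :
    MellinConvergent (truncate R δ) s :=
  mellinConvergent_of_isBigO_rpow (locallyIntegrableOn_truncate hR) (truncate_isBigO_atTop _)
    (lt_add_one _) ((truncate_isBigO _).trans hRO) hs

theorem differentiableOn_remainderZeta (hR : LocallyIntegrableOn R (Ioi 0))
    (hRO : R =O[𝓝[>] 0] fun t : ℝ => t ^ (-σ₀)) :
    DifferentiableOn ℂ (remainderZeta R δ) (halfPlane σ₀) := fun _ hs =>
  (mellin_differentiableAt_of_isBigO_rpow (locallyIntegrableOn_truncate hR)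
    (truncate_isBigO_atTop _) (lt_add_one _) ((truncate_isBigO _).trans hRO)
    (mem_halfPlane_coe.1 hs)).differentiableWithinAt

theorem isContinuation_remainderZeta (hR : LocallyIntegrableOn R (Ioi 0))
    (hRO : R =O[𝓝[>] 0] fun t : ℝ => t ^ (-σ₀)) (hD : σ₀ ≤ D) :
    IsContinuation (remainderZeta R δ) D (halfPlane σ₀) (remainderZeta R δ) ∅ where
  isOpen := isOpen_halfPlane _
  holomorphic := (differentiableOn_remainderZeta hR hRO).mono fun _ hs =>
    (EReal.coe_le_coe_iff.2 hD).trans_lt hs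
  eqOn := eqOn_refl _ _
  discrete z _ := by simp [AccPt]
  differentiableOn := (differentiableOn_remainderZeta hR hRO).mono sdiff_subset

theorem isScreenExtension_remainderZeta (hR : LocallyIntegrableOn R (Ioi 0))
    (hRO : R =O[𝓝[>] 0] fun t : ℝ => t ^ (-σ₀)) (hσ₀S : ∀ τ, σ₀ < S τ) (hSD : ∀ τ, S τ ≤ D) :
    IsScreenExtension (remainderZeta R δ) D S (remainderZeta R δ) ∅ :=
  ⟨⟨halfPlane σ₀, window_subset_halfPlane hσ₀S,
    isContinuation_remainderZeta hR hRO ((hσ₀S 0).le.trans (hSD 0))⟩,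
    halfPlane_subset_window hSD, fun _ => notMem_empty _⟩

theorem exists_norm_remainderZeta_le (hR : LocallyIntegrableOn R (Ioi 0))
    (hRO : R =O[𝓝[>] 0] fun t : ℝ => t ^ (-σ₀)) {a : ℝ} (ha : σ₀ < a) (b : ℝ) :
    ∃ C > 0, ∀ s : ℂ, s.re ∈ Icc a b → ‖remainderZeta R δ s‖ ≤ C := by
  rcases le_or_gt a b with hab | hab
  · have hconv : ∀ x : ℝ, a ≤ x → MellinConvergent (truncate R δ) x := fun x hx =>
      mellinConvergent_truncate hR hRO (ha.trans_le hx)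
    exact ⟨max 1 _, lt_max_of_lt_left one_pos, fun s hs => le_max_of_le_right
      (norm_mellin_le_of_re_mem_Icc (hconv a le_rfl) (hconv b hab) hs)⟩
  · exact ⟨1, one_pos, fun s hs => absurd (hs.1.trans hs.2) hab.not_ge⟩

theorem languid_remainderZeta (hR : LocallyIntegrableOn R (Ioi 0))
    (hRO : R =O[𝓝[>] 0] fun t : ℝ => t ^ (-σ₀)) {a : ℝ} (ha : σ₀ < a) (haS : ∀ τ, a ≤ S τ)
    (hSD : ∀ τ, S τ ≤ D) :
    (∀ T, AdmissibleHeights T → LanguidL1 (remainderZeta R δ) 0 S T) ∧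
      LanguidL2 (remainderZeta R δ) 0 S := by
  have hext := isScreenExtension_remainderZeta (δ := δ) hR hRO (fun τ => ha.trans_le (haS τ)) hSD
  obtain ⟨C, hC, hbound⟩ := exists_norm_remainderZeta_le (δ := δ) hR hRO ha (D + 1)
  exact ⟨fun T hT => hext.languidL1 hT (lt_add_one D) hC fun n σ hσ =>
      ⟨notMem_empty _, hbound _ ⟨(haS _).trans hσ.1, hσ.2⟩⟩,
    hext.languidL2 hC fun τ => hbound _ ⟨haS τ, (hSD τ).trans (lt_add_one D).le⟩⟩

theorem ScalingOperator.isAdmissibleScreen_of_le_norm_zetaDenom {L : ScalingOperator}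
    (hL : ∀ r ∈ L.support, r.1 < 1) (hR : LocallyIntegrableOn R (Ioi 0))
    (hRO : R =O[𝓝[>] 0] fun t : ℝ => t ^ (-σ₀)) (hS : IsScreen S) {a : ℝ} (ha : σ₀ < a)
    (haS : ∀ τ, a ≤ S τ) {c : ℝ} (hc : 0 < c) (hSc : ∀ τ, c ≤ ‖L.zetaDenom (screenPoint S τ)‖) :
    IsAdmissibleScreen L R δ S := by
  obtain ⟨M, hM⟩ := hS.1
  obtain ⟨T, hT, hTL⟩ := exists_languidL1_zeta hL hS fun τ => norm_pos_iff.1 (hc.trans_le (hSc τ))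
  obtain ⟨hR1, hR2⟩ :=
    languid_remainderZeta (δ := δ) hR hRO ha haS fun τ => le_of_abs_le (hM τ)
  obtain ⟨D, hD, hσ₀D⟩ :=
    ((L.eventually_zetaDenom_ne_zero hL).and (eventually_ge_atTop σ₀)).exists
  have hRcont := fun {D : ℝ} => isContinuation_remainderZeta (D := D) (δ := δ) hR hRO
  have habscissa : jointAbscissa L.zeta (remainderZeta R δ) ≤ σ₀ :=
    sInf_le ⟨EReal.coe_lt_top σ₀, extendsToHalfPlane_zeta hL _, σ₀, _, _, hRcont le_rfl⟩
  refine ⟨⟨σ₀, fun s hs => mellinConvergent_truncate hR hRO (mem_halfPlane_coe.1 hs),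
    differentiableOn_remainderZeta hR hRO⟩, ?_⟩
  exact
    { holomorphic := ⟨D, (isContinuation_zeta hD isOpen_univ).holomorphic,
        (hRcont hσ₀D).holomorphic⟩
      isScreen := hS
      mem_halfPlane := fun τ =>
        habscissa.trans_lt (EReal.coe_lt_coe_iff.2 (ha.trans_le (haS τ)))
      languidL1 := ⟨T, hTL, hR1 T hT⟩
      languidL2 := ⟨languidL2_zeta hL hS hc hSc, hR2⟩ }

end Remainder

/-! ### The lower similarity dimension -/

namespace SelfSimilarSystem

variable {X : Type*} [MetricSpace X] (Φ : SelfSimilarSystem X)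

theorem lt_one_of_mem_support_scalingOperator :
    ∀ r ∈ Φ.scalingOperator.support, r.1 < 1 := fun r hr => by
  obtain ⟨φ, hφ, hrφ⟩ := Finset.mem_biUnion.1 (Finsupp.support_finsetSum hr)
  rw [Finset.mem_singleton.1 (Finsupp.support_single_subset hrφ)]
  exact_mod_cast Φ.ratio_lt_one φ hφ

theorem zetaDenom_scalingOperator (s : ℂ) :
    Φ.scalingOperator.zetaDenom s = 1 - ∑ r ∈ Φ.ratios, (Φ.mult r : ℂ) * (r : ℂ) ^ s := by
  have hmaps : (Φ.scalingOperator.sum fun r a => (a : ℂ) * ((r.1 : ℝ) : ℂ) ^ s) =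
      ∑ φ ∈ Φ.maps, ((Dilation.ratio φ : ℝ) : ℂ) ^ s := by
    rw [scalingOperator, ← Finsupp.sum_finsetSum_index (by simp) (by intros; push_cast; ring)]
    refine Finset.sum_congr rfl fun φ _ => ?_
    rw [Finsupp.sum_single_index (by simp), ofReal_one, one_mul]
  have hfibers := Finset.sum_comp (s := Φ.maps) (fun r : ℝ => (r : ℂ) ^ s)
    fun φ => (Dilation.ratio φ : ℝ)
  rw [ScalingOperator.zetaDenom, hmaps, hfibers]
  simp only [nsmul_eq_mul, mult, ratios]

theorem lowerPoly_strictMono : StrictMono Φ.lowerPoly := by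
  have hm : (0 : ℝ) < 1 / (Φ.mult Φ.minRatio : ℝ) :=
    one_div_pos.2 (by exact_mod_cast Φ.mult_pos Φ.minRatio_mem)
  intro x y hxy
  exact add_lt_add_of_lt_of_le
    (mul_lt_mul_of_pos_left (Real.rpow_lt_rpow_of_exponent_lt Φ.one_lt_inv_minRatio hxy) hm)
    (Finset.sum_le_sum fun r hr => mul_le_mul_of_nonneg_left
      (Real.rpow_le_rpow_of_exponent_le (Φ.one_lt_div_minRatio hr).le hxy.le) (by positivity))

theorem lowerPoly_lt_one {t : ℝ} (ht : t < Φ.lowerSimDim) : Φ.lowerPoly t < 1 :=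
  Φ.lowerPoly_lowerSimDim ▸ Φ.lowerPoly_strictMono ht

theorem mult_mul_rpow_mul_lowerPoly (t : ℝ) :
    Φ.mult Φ.minRatio * Φ.minRatio ^ t * Φ.lowerPoly t =
      1 + ∑ r ∈ Φ.ratios.erase Φ.minRatio, Φ.mult r * r ^ t := by
  have hr := Φ.ratios_pos Φ.minRatio_mem
  have hm : (Φ.mult Φ.minRatio : ℝ) ≠ 0 := by exact_mod_cast (Φ.mult_pos Φ.minRatio_mem).ne'
  have hp : Φ.minRatio ^ t ≠ 0 := (Real.rpow_pos_of_pos hr t).ne'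
  rw [lowerPoly, mul_add, Finset.mul_sum]
  congr 1
  · rw [Real.inv_rpow hr.le]
    field_simp
  · refine Finset.sum_congr rfl fun r hr' => ?_
    rw [Real.div_rpow (Φ.ratios_pos (Finset.mem_of_mem_erase hr')).le hr.le]
    field_simp

theorem norm_mult_mul_cpow {r : ℝ} (hr : r ∈ Φ.ratios) (s : ℂ) :
    ‖(Φ.mult r : ℂ) * (r : ℂ) ^ s‖ = Φ.mult r * r ^ s.re := by
  rw [norm_mul, norm_natCast, norm_cpow_eq_rpow_re_of_pos (Φ.ratios_pos hr)]

theorem mult_mul_rpow_mul_one_sub_lowerPoly_le (s : ℂ) :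
    Φ.mult Φ.minRatio * Φ.minRatio ^ s.re * (1 - Φ.lowerPoly s.re) ≤
      ‖Φ.scalingOperator.zetaDenom s‖ := by
  set top : ℂ := (Φ.mult Φ.minRatio : ℂ) * (Φ.minRatio : ℂ) ^ s
  set rest : ℂ := 1 - ∑ r ∈ Φ.ratios.erase Φ.minRatio, (Φ.mult r : ℂ) * (r : ℂ) ^ s
  have hsplit : Φ.scalingOperator.zetaDenom s = rest - top := by
    rw [zetaDenom_scalingOperator, ← Finset.sum_erase_add _ _ Φ.minRatio_mem, sub_add_eq_sub_sub]
  have hrest : ‖rest‖ ≤ 1 + ∑ r ∈ Φ.ratios.erase Φ.minRatio, Φ.mult r * r ^ s.re :=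
    norm_sub_le_of_le (norm_one (α := ℂ)).le <| norm_sum_le_of_le _ fun r hr =>
      (Φ.norm_mult_mul_cpow (Finset.mem_of_mem_erase hr) s).le
  calc Φ.mult Φ.minRatio * Φ.minRatio ^ s.re * (1 - Φ.lowerPoly s.re)
      = ‖top‖ - (1 + ∑ r ∈ Φ.ratios.erase Φ.minRatio, Φ.mult r * r ^ s.re) := by
        rw [mul_one_sub, mult_mul_rpow_mul_lowerPoly, Φ.norm_mult_mul_cpow Φ.minRatio_mem]
    _ ≤ ‖top‖ - ‖rest‖ := by gcongr
    _ ≤ ‖Φ.scalingOperator.zetaDenom s‖ := by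
        rw [hsplit, norm_sub_rev rest top]
        exact norm_sub_norm_le top rest

theorem exists_forall_re_le_le_norm_zetaDenom {b : ℝ} (hb : b < Φ.lowerSimDim) :
    ∃ c > 0, ∀ s : ℂ, s.re ≤ b → c ≤ ‖Φ.scalingOperator.zetaDenom s‖ := by
  have hr := Φ.ratios_pos Φ.minRatio_mem
  have hm : (0 : ℝ) < Φ.mult Φ.minRatio := by exact_mod_cast Φ.mult_pos Φ.minRatio_mem
  have hgap : 0 < 1 - Φ.lowerPoly b := sub_pos.2 (Φ.lowerPoly_lt_one hb)
  refine ⟨Φ.mult Φ.minRatio * Φ.minRatio ^ b * (1 - Φ.lowerPoly b), by positivity,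
    fun s hs => le_trans ?_ (Φ.mult_mul_rpow_mul_one_sub_lowerPoly_le s)⟩
  have hpow : Φ.minRatio ^ b ≤ Φ.minRatio ^ s.re :=
    Real.rpow_le_rpow_of_exponent_ge hr (Φ.ratios_lt_one Φ.minRatio_mem).le hs
  have hpoly : Φ.lowerPoly s.re ≤ Φ.lowerPoly b := Φ.lowerPoly_strictMono.monotone hs
  gcongr

end SelfSimilarSystem

theorem mainTheorem11_general {X : Type*} [MetricSpace X] (Φ : SelfSimilarSystem X)
    {R : ℝ → ℝ} (hR : LocallyIntegrableOn R (Ioi 0)) {σ₀ : ℝ}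
    (hRO : R =O[𝓝[>] 0] fun t : ℝ => t ^ (-σ₀)) (δ : ℝ) {S : ℝ → ℝ} (hS : IsScreen S) {a b : ℝ}
    (ha : σ₀ < a) (hb : b < Φ.lowerSimDim) (hSab : ∀ τ, S τ ∈ Icc a b) :
    IsAdmissibleScreen Φ.scalingOperator R δ S := by
  obtain ⟨c, hc, hcb⟩ := Φ.exists_forall_re_le_le_norm_zetaDenom hb
  exact ScalingOperator.isAdmissibleScreen_of_le_norm_zetaDenom
    Φ.lt_one_of_mem_support_scalingOperator hR hRO hS ha (fun τ => (hSab τ).1) hc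
    fun τ => hcb _ (hSab τ).2

theorem mainTheorem11 {X : Type*} [MetricSpace X] [CompleteSpace X] (Φ : SelfSimilarSystem X)
    (R : ℝ → ℝ) (hR : ContinuousOn R (Set.Ioi 0)) (σ₀ : ℝ) (hσ₀ : σ₀ < Φ.lowerSimDim)
    (hRO : R =O[𝓝[>] 0] fun t : ℝ => t ^ (-σ₀)) (δ : ℝ) (hδ : 0 < δ) :
    IsAdmissibleRemainder Φ.scalingOperator R δ ∧
      ∀ ε : ℝ, 0 < ε → ε < Φ.lowerSimDim - σ₀ →
        IsAdmissibleScreen Φ.scalingOperator R δ (fun _ => σ₀ + ε) := by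
  have hconst {a : ℝ} (ha : σ₀ < a) (ha' : a < Φ.lowerSimDim) :=
    mainTheorem11_general Φ (hR.locallyIntegrableOn measurableSet_Ioi) hRO δ (isScreen_const a)
      ha ha' fun _ => ⟨le_rfl, le_rfl⟩
  obtain ⟨a, ha, ha'⟩ := exists_between hσ₀
  exact ⟨⟨_, hconst ha ha'⟩, fun ε hε hε' => hconst (by linarith) (by linarith)⟩
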